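/- Let $\alpha, c > 0$, and let $H_0$ be a finite measure on a measurable space $\Omega$ with total mass $\gamma = H_0(\Omega) > 0$. For $i, j = 1, 2, \dots$ let $C_i \sim \mathrm{Poisson}(\gamma)$, $E_{ij} \sim \mathrm{Exp}(c)$ (rate $c$), $T_{ij} \sim \mathrm{Gamma}(i, \alpha)$ (shape $i$, rate $\alpha$), and $\omega_{ij} \sim \frac{1}{\gamma} H_0$, all of these random variables being mutually independent. Put $G_0 = \frac{\alpha}{c} H_0$. Then the points $(\omega_{ij}, E_{ij} e^{-T_{ij}})$, $i \ge 1$, $1 \le j \le C_i$, form a Poisson process on $\Omega \times (0, \infty)$ with rate measure $$H(d\omega, dp) = c\, p^{-1} e^{-cp}\, G_0(d\omega)\, dp;$$ that is, the number of points in a measurable set $B$ is Poisson distributed with mean $H(B)$ (and is almost surely infinite if $H(B) = \infty$), and the numbers of points in pairwise disjoint measurable sets are independent. Consequently, the random measure $$G = \sum_{i=1}^{\infty} \sum_{j=1}^{C_i} E_{ij} e^{-T_{ij}}\, \delta_{\omega_{ij}}$$ is a gamma completely random measure with concentration parameter $c$ and base measure $G_0$: it is almost surely finite, its values on pairwise disjoint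 measurable sets are independent, and it is of the form $\sum_k p_k \delta_{\omega_k}$, where the points $(\omega_k, p_k)$ form a Poisson process with rate measure $H$. -/

import Mathlib

open MeasureTheory ProbabilityTheory
open scoped ENNReal NNReal

noncomputable section

/-- The Poisson distribution with mean `m ∈ [0, ∞]`, as a law on `[0, ∞]`; for `m = ∞` it is the
point mass at `∞`. -/
def poissonLaw (m : ℝ≥0∞) : Measure ℝ≥0∞ :=
  if m = ∞ then Measure.dirac ∞ else (poissonMeasure m.toNNReal).map (fun n : ℕ => (n : ℝ≥0∞))

/-- A random measure `G` on `S` (defined on the probability space `(Θ, P)`) is completely random if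
its values on pairwise disjoint measurable sets are independent. -/
structure IsCompletelyRandomMeasure {Θ S : Type*} [MeasurableSpace Θ] [MeasurableSpace S]
    (G : Θ → Measure S) (P : Measure Θ) : Prop where
  measurable : Measurable G
  indep : ∀ (n : ℕ) (A : Fin n → Set S), (∀ k, MeasurableSet (A k)) →
    Pairwise (fun k l => Disjoint (A k) (A l)) → iIndepFun (fun k θ => G θ (A k)) P

/-- `N`, a random measure on `S`, is (the counting measure of) a Poisson process with rate measure
`μ`: it is almost surely a countable sum of unit point masses, the numbers of points in disjoint
measurable sets are independent, and the number of points in a measurable set `B` is Poisson with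
mean `μ B`. -/
structure IsPoissonProcess {Θ S : Type*} [MeasurableSpace Θ] [MeasurableSpace S]
    (N : Θ → Measure S) (μ : Measure S) (P : Measure Θ) : Prop where
  measurable : Measurable N
  counting : ∀ᵐ θ ∂P, ∃ (K : Set ℕ) (x : K → S),
    N θ = Measure.sum (fun k : K => Measure.dirac (x k))
  law : ∀ B : Set S, MeasurableSet B → P.map (fun θ => N θ B) = poissonLaw (μ B)
  indep : ∀ (n : ℕ) (A : Fin n → Set S), (∀ k, MeasurableSet (A k)) →
    Pairwise (fun k l => Disjoint (A k) (A l)) → iIndepFun (fun k θ => N θ (A k)) P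

/-- The rate measure `c p⁻¹ e^{-cp} G₀(dω) dp` on `Ω × (0, ∞)`, as a measure on `Ω × ℝ`. -/
def gammaRate {Ω : Type*} [MeasurableSpace Ω] (c : ℝ) (G₀ : Measure Ω) : Measure (Ω × ℝ) :=
  G₀.prod ((volume.restrict (Set.Ioi (0 : ℝ))).withDensity
    (fun p => ENNReal.ofReal (c * p⁻¹ * Real.exp (-(c * p)))))

/-- For the counting measure `N` of points `(ω_k, p_k)`, this is the measure `∑ p_k δ_{ω_k}`,
that is `B ↦ ∑_{k : ω_k ∈ B} p_k`. -/
def weightedAtoms {Ω : Type*} [MeasurableSpace Ω] (N : Measure (Ω × ℝ)) : Measure Ω :=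
  (N.withDensity (fun x => ENNReal.ofReal x.2)).map Prod.fst

/-- `G` is a gamma completely random measure (gamma process) with concentration `c` and base
measure `G₀`: a completely random, almost surely finite measure of the form `∑ p_k δ_{ω_k}`, where
the points `(ω_k, p_k)` form a Poisson process with rate measure `c p⁻¹ e^{-cp} G₀(dω) dp`. -/
structure IsGammaCRM {Θ Ω : Type*} [MeasurableSpace Θ] [MeasurableSpace Ω]
    (G : Θ → Measure Ω) (c : ℝ) (G₀ : Measure Ω) (P : Measure Θ) : Prop where
  completelyRandom : IsCompletelyRandomMeasure G P
  finite : ∀ᵐ θ ∂P, G θ Set.univ < ∞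
  exists_poisson : ∃ N : Θ → Measure (Ω × ℝ), IsPoissonProcess N (gammaRate c G₀) P ∧
    ∀ᵐ θ ∂P, G θ = weightedAtoms (N θ)

/-- The counting measure of the points `(ω_ij, E_ij e^{-T_ij})`, over all rounds `i` and all
`j` among the first `C_i`. Indices start at `0`. -/
def stickPoints {Θ Ω : Type*} [MeasurableSpace Ω] (C : ℕ → Θ → ℕ) (E T : ℕ → ℕ → Θ → ℝ)
    (X : ℕ → ℕ → Θ → Ω) (θ : Θ) : Measure (Ω × ℝ) :=
  Measure.sum fun i : ℕ => ∑ j ∈ Finset.range (C i θ),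
    Measure.dirac (X i j θ, E i j θ * Real.exp (-T i j θ))

/-- The random measure `∑_i ∑_{j ≤ C_i} E_ij e^{-T_ij} δ_{ω_ij}`. Indices start at `0`. -/
def stickMeasure {Θ Ω : Type*} [MeasurableSpace Ω] (C : ℕ → Θ → ℕ) (E T : ℕ → ℕ → Θ → ℝ)
    (X : ℕ → ℕ → Θ → Ω) (θ : Θ) : Measure Ω :=
  Measure.sum fun i : ℕ => ∑ j ∈ Finset.range (C i θ),
    ENNReal.ofReal (E i j θ * Real.exp (-T i j θ)) • Measure.dirac (X i j θ)

/-- All the variables `C_i`, `E_ij`, `T_ij`, `X_ij` (of all four arrays together) are mutually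
independent. -/
def StickIndep {Θ Ω : Type*} [MeasurableSpace Θ] [MeasurableSpace Ω] (C : ℕ → Θ → ℕ)
    (E T : ℕ → ℕ → Θ → ℝ) (X : ℕ → ℕ → Θ → Ω) (P : Measure Θ) : Prop :=
  iIndep (ι := ℕ ⊕ (ℕ × ℕ) ⊕ (ℕ × ℕ) ⊕ (ℕ × ℕ))
    (Sum.elim (fun i => MeasurableSpace.comap (C i) inferInstance)
      (Sum.elim (fun a => MeasurableSpace.comap (E a.1 a.2) inferInstance)
        (Sum.elim (fun a => MeasurableSpace.comap (T a.1 a.2) inferInstance)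
          (fun a => MeasurableSpace.comap (X a.1 a.2) inferInstance)))) P

end

/-!
The theorem is proved with the Laplace functional. Call a random measure `N` on `S` of Poisson type
with rate measure `μ` (`HasPoissonLaplace`) if `E exp (-∫ f dN) = exp (-∫ (1 - exp (-f)) dμ)` for
every measurable `f : S → [0, ∞]`.

This identity contains everything that is claimed. For `f = n • 1_B` it is the Laplace transform of
the Poisson law with mean `μ B`, including the case `μ B = ∞`. If `f₁, …, f_k` have disjoint
supports, then `1 - exp (-·)` is additive on their combinations, so the joint Laplace transform of
the integrals `∫ f_i dN` factors and these integrals are independent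
(`HasPoissonLaplace.iIndepFun_lintegral`); indicators of disjoint sets give the independence of the
counts, and the functions `(ω, p) ↦ p 1_A(ω)` give that of the values of `∑ p_k δ_{ω_k}`.
Replacing `f` by `f / n` and letting `n → ∞` shows that `∫ f dN` is almost surely finite when
`∫ f dμ` is. Laws on `[0, ∞]ⁿ` are determined by their Laplace transforms at natural numbers, since
the functions `exp (-y_k)` generate a separating algebra of continuous functions on a compact space
(`measure_pi_ext_of_forall_lintegral_expNeg`).

The stick-breaking points have such a Laplace functional (`hasPoissonLaplace_stickPoints`). By
independence and the generating function of the Poisson distribution, round `i` contributes the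
factor `exp (-γ E[1 - exp (-f (ξ_i))])`, where `ξ_i` is a point of round `i`. It remains to see
that the laws of the `ξ_i`, multiplied by `γ`, add up to the rate measure
(`tsum_lintegral_point`). The `Gamma (i, α)` densities add up to the constant `α` on `(0, ∞)`, and
`∫ α · c exp t · exp (-c p exp t) dt = α p⁻¹ exp (-c p)` over `t > 0`
(`tsum_lintegral_expMeasure_gammaMeasure`).
-/

open Filter Topology

noncomputable section

/-! ### The function `y ↦ exp (-y)` on `[0, ∞]` -/

/-- The function `y ↦ exp (-y)` on `[0, ∞]`, with values in `[0, 1]` and value `0` at `∞`. -/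
def expNeg (y : ℝ≥0∞) : ℝ≥0∞ := EReal.exp (-(y : EReal))

@[simp] lemma expNeg_zero : expNeg 0 = 1 := by simp [expNeg]

@[simp] lemma expNeg_top : expNeg ∞ = 0 := by simp [expNeg]

lemma expNeg_le_one (y : ℝ≥0∞) : expNeg y ≤ 1 := by
  simp only [expNeg, EReal.exp_le_one_iff]
  simpa using EReal.neg_le_neg_iff.2 (EReal.coe_ennreal_nonneg y)

lemma expNeg_ne_top (y : ℝ≥0∞) : expNeg y ≠ ∞ :=
  ((expNeg_le_one y).trans_lt ENNReal.one_lt_top).ne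

lemma continuous_expNeg : Continuous expNeg :=
  ENNReal.continuous_exp.comp (continuous_neg.comp continuous_coe_ennreal_ereal)

@[fun_prop]
lemma measurable_expNeg : Measurable expNeg := continuous_expNeg.measurable

lemma expNeg_injective : Function.Injective expNeg := fun a b h => by
  simpa using EReal.exp_strictMono.injective h

lemma expNeg_antitone : Antitone expNeg := fun a b h => by
  simpa [expNeg] using h

lemma expNeg_add (a b : ℝ≥0∞) : expNeg (a + b) = expNeg a * expNeg b := by
  rw [expNeg, expNeg, expNeg, ← EReal.exp_add, EReal.coe_ennreal_add, EReal.neg_add,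
    sub_eq_add_neg]
  · exact Or.inl (by simp)
  · exact Or.inr (by simp)

lemma expNeg_sum {κ : Type*} (s : Finset κ) (f : κ → ℝ≥0∞) :
    expNeg (∑ k ∈ s, f k) = ∏ k ∈ s, expNeg (f k) := by
  classical
  induction s using Finset.induction_on with
  | empty => simp
  | insert a s ha ih => rw [Finset.sum_insert ha, Finset.prod_insert ha, expNeg_add, ih]

lemma expNeg_natCast_mul (n : ℕ) (y : ℝ≥0∞) : expNeg (n * y) = expNeg y ^ n := by
  have := expNeg_sum (Finset.range n) (fun _ => y)
  simpa using this

lemma expNeg_ofReal {x : ℝ} (hx : 0 ≤ x) :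
    expNeg (ENNReal.ofReal x) = ENNReal.ofReal (Real.exp (-x)) := by
  rw [expNeg, EReal.coe_ennreal_ofReal, max_eq_left hx, ← EReal.coe_neg, EReal.exp_coe]

lemma tendsto_prod_expNeg (f : ℕ → ℝ≥0∞) :
    Tendsto (fun n => ∏ i ∈ Finset.range n, expNeg (f i)) atTop (𝓝 (expNeg (∑' i, f i))) := by
  simp_rw [← expNeg_sum]
  exact (continuous_expNeg.tendsto _).comp (ENNReal.tendsto_nat_tsum f)

/-! ### Laws on `[0, ∞]ⁿ` are determined by their Laplace transforms -/

/-- A finite measure on a Polish space is determined by the integrals of the monomials in a family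
of bounded continuous functions that separates points: polynomials in these functions form a
separating star subalgebra. -/
lemma measure_ext_of_forall_integral_prod_pow {ι E : Type*} [Fintype ι] [TopologicalSpace E]
    [PolishSpace E] [MeasurableSpace E] [BorelSpace E] {μ ν : Measure E} [IsFiniteMeasure μ]
    [IsFiniteMeasure ν] (q : ι → BoundedContinuousFunction E ℝ)
    (hsep : ∀ x y, (∀ k, q k x = q k y) → x = y)
    (h : ∀ n : ι → ℕ, ∫ x, ∏ k, q k x ^ n k ∂μ = ∫ x, ∏ k, q k x ^ n k ∂ν) : μ = ν := by
  let A : StarSubalgebra ℝ (BoundedContinuousFunction E ℝ) :=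
    { (MvPolynomial.aeval q : MvPolynomial ι ℝ →ₐ[ℝ] _).range with
      star_mem' := fun {a} ha => by
        have : star a = a := by ext x; simp
        rwa [this] }
  have hqA : ∀ k, q k ∈ A := fun k => ⟨MvPolynomial.X k, by simp⟩
  refine ext_of_forall_mem_subalgebra_integral_eq_of_polish (𝕜 := ℝ) (A := A) ?_ ?_
  · intro x y hxy
    obtain ⟨k, hk⟩ : ∃ k, q k x ≠ q k y := by
      by_contra! hc
      exact hxy (hsep x y hc)
    refine ⟨q k, ⟨_, ⟨q k, hqA k, rfl⟩, rfl⟩, hk⟩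
  · rintro _ ⟨p, rfl⟩
    have key : ∀ x, (MvPolynomial.aeval q p : BoundedContinuousFunction E ℝ) x
        = ∑ m ∈ p.support, p.coeff m * ∏ k, q k x ^ m k := by
      intro x
      let ev : BoundedContinuousFunction E ℝ →ₐ[ℝ] ℝ :=
        { toFun := fun g => g x
          map_one' := rfl
          map_mul' := fun _ _ => rfl
          map_zero' := rfl
          map_add' := fun _ _ => rfl
          commutes' := fun _ => rfl }
      change ev (MvPolynomial.aeval q p) = _
      rw [MvPolynomial.aeval_def, MvPolynomial.eval₂_eq', map_sum]
      simp only [map_mul, map_prod, map_pow, AlgHom.commutes]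
      rfl
    have hint : ∀ (ρ : Measure E) [IsFiniteMeasure ρ] (m : ι →₀ ℕ),
        Integrable (fun x => ∏ k, q k x ^ m k) ρ := fun ρ _ m => by
      have := (∏ k, q k ^ m k : BoundedContinuousFunction E ℝ).integrable ρ
      refine this.congr (ae_of_all _ fun x => ?_)
      simp
    have hval : ∀ (ρ : Measure E) [IsFiniteMeasure ρ],
        ∫ x, (MvPolynomial.aeval q p : BoundedContinuousFunction E ℝ) x ∂ρ
          = ∑ m ∈ p.support, p.coeff m * ∫ x, ∏ k, q k x ^ m k ∂ρ := fun ρ _ => by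
      simp_rw [key]
      rw [integral_finsetSum _ fun m _ => (hint ρ m).const_mul _]
      simp_rw [integral_const_mul]
    refine (hval μ).trans (Eq.trans ?_ (hval ν).symm)
    exact Finset.sum_congr rfl fun m _ => by rw [h m]

/-- The bounded continuous real function `y ↦ exp (-y)` on `[0, ∞]`. -/
def expNegReal : BoundedContinuousFunction ℝ≥0∞ ℝ :=
  BoundedContinuousFunction.mkOfBound
    ⟨fun y => (expNeg y).toReal, ENNReal.continuousOn_toReal.comp_continuous continuous_expNeg
      expNeg_ne_top⟩ 1 fun x y => by
    have h (z : ℝ≥0∞) : (expNeg z).toReal ∈ Set.Icc (0 : ℝ) 1 :=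
      ⟨ENNReal.toReal_nonneg, ENNReal.toReal_le_of_le_ofReal zero_le_one
        (by simpa using expNeg_le_one z)⟩
    simpa using Real.dist_le_of_mem_Icc (h x) (h y)

lemma expNegReal_apply (y : ℝ≥0∞) : expNegReal y = (expNeg y).toReal := rfl

/-- A finite measure on `[0, ∞]ⁿ` is determined by its Laplace transform at the points with
natural-number coordinates. -/
lemma measure_pi_ext_of_forall_lintegral_expNeg {ι : Type*} [Fintype ι]
    {μ ν : Measure (ι → ℝ≥0∞)} [IsFiniteMeasure μ] [IsFiniteMeasure ν]
    (h : ∀ n : ι → ℕ, ∫⁻ y, expNeg (∑ k, n k * y k) ∂μ = ∫⁻ y, expNeg (∑ k, n k * y k) ∂ν) :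
    μ = ν := by
  refine measure_ext_of_forall_integral_prod_pow
    (fun k => expNegReal.compContinuous ⟨fun y : ι → ℝ≥0∞ => y k, continuous_apply k⟩)
    (fun x y hxy => ?_) fun n => ?_
  · funext k
    exact expNeg_injective ((ENNReal.toReal_eq_toReal_iff' (expNeg_ne_top _) (expNeg_ne_top _)).1
      (hxy k))
  · have hprod : ∀ y : ι → ℝ≥0∞, ∏ k, expNegReal (y k) ^ n k
        = (expNeg (∑ k, n k * y k)).toReal := fun y => by
      simp [expNeg_sum, expNeg_natCast_mul, expNegReal_apply, ENNReal.toReal_prod]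
    have hval : ∀ ρ : Measure (ι → ℝ≥0∞), ∫ y, ∏ k, expNegReal (y k) ^ n k ∂ρ
        = (∫⁻ y, expNeg (∑ k, n k * y k) ∂ρ).toReal := fun ρ => by
      simp_rw [hprod]
      exact integral_toReal (by fun_prop : Measurable _).aemeasurable
        (ae_of_all _ fun y => (expNeg_ne_top _).lt_top)
    exact (hval μ).trans ((congrArg _ (h n)).trans (hval ν).symm)

/-- A finite measure on `[0, ∞]` is determined by its Laplace transform on `ℕ`. -/
lemma measure_ext_of_forall_lintegral_expNeg {μ ν : Measure ℝ≥0∞} [IsFiniteMeasure μ]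
    [IsFiniteMeasure ν] (h : ∀ n : ℕ, ∫⁻ y, expNeg (n * y) ∂μ = ∫⁻ y, expNeg (n * y) ∂ν) :
    μ = ν := by
  have hmap : μ.map (fun y (_ : Unit) => y) = ν.map (fun y (_ : Unit) => y) := by
    refine measure_pi_ext_of_forall_lintegral_expNeg fun n => ?_
    rw [lintegral_map (by fun_prop) (by fun_prop), lintegral_map (by fun_prop) (by fun_prop)]
    simpa using h (n ())
  have hproj : ∀ ρ : Measure ℝ≥0∞, (ρ.map (fun y (_ : Unit) => y)).map (fun z => z ()) = ρ :=
    fun ρ => by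
      rw [Measure.map_map (by fun_prop) (by fun_prop)]
      exact Measure.map_id
  rw [← hproj μ, hmap, hproj ν]

/-! ### Random measures with the Laplace functional of a Poisson process -/

/-- The Laplace functional of `N` is that of a Poisson process with rate measure `μ`:
`E exp (-∫ f dN) = exp (-∫ (1 - exp (-f)) dμ)` for every measurable `f ≥ 0`. -/
def HasPoissonLaplace {Θ S : Type*} [MeasurableSpace Θ] [MeasurableSpace S]
    (N : Θ → Measure S) (μ : Measure S) (P : Measure Θ) : Prop :=
  ∀ f : S → ℝ≥0∞, Measurable f →
    ∫⁻ θ, expNeg (∫⁻ x, f x ∂N θ) ∂P = expNeg (∫⁻ x, (1 - expNeg (f x)) ∂μ)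

/-- The probability generating function of the Poisson distribution. -/
lemma lintegral_pow_poissonMeasure (r : ℝ≥0) {a : ℝ≥0∞} (ha : a ≤ 1) :
    ∫⁻ k, a ^ k ∂poissonMeasure r = expNeg (r * (1 - a)) := by
  lift a to ℝ≥0 using (ha.trans_lt ENNReal.one_lt_top).ne
  have ha' : (a : ℝ) ≤ 1 := by exact_mod_cast ha
  have hterm : ∀ k : ℕ, ENNReal.ofReal (Real.exp (-r) * r ^ k / k.factorial) * (a : ℝ≥0∞) ^ k
      = ENNReal.ofReal (Real.exp (-r) * ((r * a : ℝ) ^ k / k.factorial)) := fun k => by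
    rw [← ENNReal.ofReal_coe_nnreal (p := a), ← ENNReal.ofReal_pow a.coe_nonneg,
      ← ENNReal.ofReal_mul (by positivity)]
    congr 1
    rw [mul_pow]
    ring
  have hsum : HasSum (fun k : ℕ => Real.exp (-r) * ((r * a : ℝ) ^ k / k.factorial))
      (Real.exp (-r) * Real.exp (r * a)) := by
    have := NormedSpace.expSeries_div_hasSum_exp (r * a : ℝ)
    rw [← Real.exp_eq_exp_ℝ] at this
    exact this.mul_left _
  rw [poissonMeasure, lintegral_sum_measure]
  simp_rw [lintegral_smul_measure, lintegral_dirac, smul_eq_mul, hterm]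
  rw [← ENNReal.ofReal_tsum_of_nonneg (fun k => by positivity) hsum.summable, hsum.tsum_eq,
    ← Real.exp_add]
  have hmul : (r : ℝ≥0∞) * (1 - a) = ENNReal.ofReal (r * (1 - a)) := by
    rw [ENNReal.ofReal_mul r.coe_nonneg, ENNReal.ofReal_coe_nnreal,
      ENNReal.ofReal_sub _ a.coe_nonneg, ENNReal.ofReal_one, ENNReal.ofReal_coe_nnreal]
  rw [hmul, expNeg_ofReal (mul_nonneg r.coe_nonneg (sub_nonneg.2 ha'))]
  congr 2
  ring

lemma lintegral_expNeg_poissonLaw (m : ℝ≥0∞) (n : ℕ) :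
    ∫⁻ y, expNeg (n * y) ∂poissonLaw m = expNeg ((1 - expNeg n) * m) := by
  by_cases hm : m = ∞
  · rw [poissonLaw, if_pos hm, lintegral_dirac' _ (by fun_prop), hm]
    rcases Nat.eq_zero_or_pos n with rfl | hn
    · simp
    · have h1 : expNeg n < 1 := by
        refine lt_of_le_of_ne (expNeg_le_one _) fun h => hn.ne' ?_
        exact_mod_cast expNeg_injective (h.trans expNeg_zero.symm)
      rw [ENNReal.mul_top (by exact_mod_cast hn.ne'), ENNReal.mul_top (tsub_pos_of_lt h1).ne']
  · rw [poissonLaw, if_neg hm, lintegral_map (by fun_prop) (by fun_prop)]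
    simp_rw [mul_comm (n : ℝ≥0∞), expNeg_natCast_mul]
    rw [lintegral_pow_poissonMeasure _ (expNeg_le_one _), ENNReal.coe_toNNReal hm, mul_comm]

instance isProbabilityMeasure_poissonLaw (m : ℝ≥0∞) : IsProbabilityMeasure (poissonLaw m) := by
  rw [poissonLaw]
  split_ifs
  · infer_instance
  · exact Measure.isProbabilityMeasure_map (by fun_prop)

lemma one_sub_expNeg_sum_of_disjoint {κ : Type*} [Fintype κ] (a : κ → ℝ≥0∞)
    (h : Pairwise fun k l => a k = 0 ∨ a l = 0) :
    1 - expNeg (∑ k, a k) = ∑ k, (1 - expNeg (a k)) := by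
  by_cases h0 : ∀ k, a k = 0
  · simp [h0]
  · push Not at h0
    obtain ⟨k, hk⟩ := h0
    have hl : ∀ l, l ≠ k → a l = 0 := fun l hlk => (h hlk).resolve_right hk
    rw [Fintype.sum_eq_single k hl, Fintype.sum_eq_single k fun l hlk => by simp [hl l hlk]]

namespace HasPoissonLaplace

variable {Θ S : Type*} [MeasurableSpace Θ] [MeasurableSpace S] {N : Θ → Measure S}
  {μ : Measure S} {P : Measure Θ} [IsProbabilityMeasure P]

/-- Integrals of functions with disjoint supports are independent, because the function
`1 - exp (-·)` is additive on such functions and the Laplace transform therefore factors. -/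
lemma iIndepFun_lintegral (h : HasPoissonLaplace N μ P) (hN : Measurable N) {κ : Type*}
    [Fintype κ] (f : κ → S → ℝ≥0∞) (hf : ∀ k, Measurable (f k))
    (hdisj : Pairwise fun k l => ∀ x, f k x = 0 ∨ f l x = 0) :
    iIndepFun (fun k θ => ∫⁻ x, f k x ∂N θ) P := by
  have hY : ∀ k, Measurable fun θ => ∫⁻ x, f k x ∂N θ := fun k =>
    (Measure.measurable_lintegral (hf k)).comp hN
  rw [iIndepFun_iff_map_fun_eq_pi_map fun k => (hY k).aemeasurable]
  have hprob : ∀ k, IsProbabilityMeasure (P.map fun θ => ∫⁻ x, f k x ∂N θ) := fun k =>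
    Measure.isProbabilityMeasure_map (hY k).aemeasurable
  refine measure_pi_ext_of_forall_lintegral_expNeg fun n => ?_
  have hone : ∀ k, ∫⁻ θ, expNeg (n k * ∫⁻ x, f k x ∂N θ) ∂P
      = expNeg (∫⁻ x, (1 - expNeg (n k * f k x)) ∂μ) := fun k => by
    rw [← h _ ((hf k).const_mul _)]
    simp_rw [lintegral_const_mul _ (hf k)]
  rw [lintegral_map (by fun_prop) (measurable_pi_lambda _ hY)]
  have hsum : ∀ θ, ∑ k, n k * ∫⁻ x, f k x ∂N θ = ∫⁻ x, ∑ k, n k * f k x ∂N θ := fun θ => by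
    rw [lintegral_finsetSum _ fun k _ => (hf k).const_mul _]
    simp_rw [lintegral_const_mul _ (hf _)]
  simp_rw [hsum]
  rw [h _ (by fun_prop)]
  have hpt : ∀ x, 1 - expNeg (∑ k, n k * f k x) = ∑ k, (1 - expNeg (n k * f k x)) := fun x =>
    one_sub_expNeg_sum_of_disjoint _ fun k l hkl => (hdisj hkl x).imp (by simp +contextual)
      (by simp +contextual)
  simp_rw [hpt]
  rw [lintegral_finsetSum _ fun k _ => by fun_prop, expNeg_sum]
  simp_rw [← hone, expNeg_sum]
  have hind : iIndepFun (fun k (y : κ → ℝ≥0∞) => expNeg (n k * y k))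
      (Measure.pi fun k => P.map fun θ => ∫⁻ x, f k x ∂N θ) :=
    iIndepFun_pi (X := fun k (z : ℝ≥0∞) => expNeg (n k * z)) fun k =>
      (by fun_prop : Measurable fun z : ℝ≥0∞ => expNeg (n k * z)).aemeasurable
  rw [lintegral_prod_eq_prod_lintegral_of_indepFun Finset.univ _ hind fun k => by fun_prop]
  refine Finset.prod_congr rfl fun k _ => ?_
  rw [← lintegral_map (f := fun z : ℝ≥0∞ => expNeg (n k * z)) (by fun_prop) (hY k)]
  exact ((measurePreserving_eval (fun k => P.map fun θ => ∫⁻ x, f k x ∂N θ) k).lintegral_comp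
    (f := fun z : ℝ≥0∞ => expNeg (n k * z)) (by fun_prop)).symm

lemma map_apply_eq_poissonLaw (h : HasPoissonLaplace N μ P) (hN : Measurable N) {B : Set S}
    (hB : MeasurableSet B) : P.map (fun θ => N θ B) = poissonLaw (μ B) := by
  have hY : Measurable fun θ => N θ B := (Measure.measurable_coe hB).comp hN
  have := Measure.isProbabilityMeasure_map (μ := P) hY.aemeasurable
  refine measure_ext_of_forall_lintegral_expNeg fun n => ?_
  rw [lintegral_expNeg_poissonLaw, lintegral_map (by fun_prop) hY]
  have hL := h (B.indicator fun _ => (n : ℝ≥0∞)) (measurable_const.indicator hB)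
  have hpt : ∀ x, 1 - expNeg (B.indicator (fun _ => (n : ℝ≥0∞)) x)
      = B.indicator (fun _ => 1 - expNeg n) x := fun x => by
    by_cases hx : x ∈ B <;> simp [hx]
  simpa only [hpt, lintegral_indicator_const hB] using hL

/-- The counts in disjoint sets are independent Poisson variables, so the Laplace functional
identifies a Poisson process. -/
lemma isPoissonProcess (h : HasPoissonLaplace N μ P) (hN : Measurable N)
    (hcount : ∀ θ, ∃ (K : Set ℕ) (x : K → S),
      N θ = Measure.sum (fun k : K => Measure.dirac (x k))) :
    IsPoissonProcess N μ P where
  measurable := hN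
  counting := ae_of_all _ hcount
  law _ hB := h.map_apply_eq_poissonLaw hN hB
  indep n A hA hdisj := by
    have := h.iIndepFun_lintegral hN (fun k => (A k).indicator fun _ => 1)
      (fun k => measurable_const.indicator (hA k)) fun k l hkl x => by
        by_cases hx : x ∈ A k
        · exact Or.inr (by simp [Set.disjoint_left.1 (hdisj hkl) hx])
        · exact Or.inl (by simp [hx])
    simpa only [lintegral_indicator_const (hA _), one_mul] using this

end HasPoissonLaplace

lemma one_sub_expNeg_le (y : ℝ≥0∞) : 1 - expNeg y ≤ y := by
  by_cases hy : y = ∞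
  · simp [hy]
  · lift y to ℝ≥0 using hy
    rw [← ENNReal.ofReal_coe_nnreal, expNeg_ofReal y.coe_nonneg, ← ENNReal.ofReal_one,
      ← ENNReal.ofReal_sub _ (Real.exp_pos _).le]
    exact ENNReal.ofReal_le_ofReal (by linarith [Real.add_one_le_exp (-(y : ℝ))])

/-- If `f` has finite integral against the rate measure, then `∫ f dN` is almost surely finite:
`exp (-∫ f dμ / n) ≤ E exp (-∫ f dN / n) ≤ P (∫ f dN < ∞)` for all `n`. -/
lemma HasPoissonLaplace.ae_lintegral_lt_top {Θ S : Type*} [MeasurableSpace Θ] [MeasurableSpace S]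
    {N : Θ → Measure S} {μ : Measure S} {P : Measure Θ} [IsProbabilityMeasure P]
    (h : HasPoissonLaplace N μ P) (hN : Measurable N) {f : S → ℝ≥0∞} (hf : Measurable f)
    (hfμ : ∫⁻ x, f x ∂μ ≠ ∞) : ∀ᵐ θ ∂P, ∫⁻ x, f x ∂N θ < ∞ := by
  have hY : Measurable fun θ => ∫⁻ x, f x ∂N θ := (Measure.measurable_lintegral hf).comp hN
  have hA : MeasurableSet {θ | ∫⁻ x, f x ∂N θ < ∞} := measurableSet_lt hY measurable_const
  have hbound : ∀ n : ℕ, expNeg ((n : ℝ≥0∞)⁻¹ * ∫⁻ x, f x ∂μ)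
      ≤ P {θ | ∫⁻ x, f x ∂N θ < ∞} := fun n => by
    calc expNeg ((n : ℝ≥0∞)⁻¹ * ∫⁻ x, f x ∂μ)
        ≤ expNeg (∫⁻ x, (1 - expNeg ((n : ℝ≥0∞)⁻¹ * f x)) ∂μ) := by
          refine expNeg_antitone ?_
          rw [← lintegral_const_mul _ hf]
          exact lintegral_mono fun x => one_sub_expNeg_le _
      _ = ∫⁻ θ, expNeg ((n : ℝ≥0∞)⁻¹ * ∫⁻ x, f x ∂N θ) ∂P := by
          rw [← h _ (hf.const_mul _)]
          simp_rw [lintegral_const_mul _ hf]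
      _ ≤ ∫⁻ θ, {θ | ∫⁻ x, f x ∂N θ < ∞}.indicator 1 θ ∂P := by
          refine lintegral_mono fun θ => ?_
          by_cases hθ : ∫⁻ x, f x ∂N θ < ∞
          · simpa [Set.indicator_of_mem (show θ ∈ {θ | ∫⁻ x, f x ∂N θ < ∞} from hθ)]
              using expNeg_le_one _
          · have hn : (n : ℝ≥0∞)⁻¹ ≠ 0 := by simp
            simp [not_lt_top_iff.1 hθ, ENNReal.mul_top hn]
      _ = P {θ | ∫⁻ x, f x ∂N θ < ∞} := lintegral_indicator_one hA
  have hlim : Tendsto (fun n : ℕ => expNeg ((n : ℝ≥0∞)⁻¹ * ∫⁻ x, f x ∂μ)) atTop (𝓝 1) := by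
    have := ENNReal.Tendsto.mul_const (b := ∫⁻ x, f x ∂μ) ENNReal.tendsto_inv_nat_nhds_zero
      (Or.inr hfμ)
    rw [zero_mul] at this
    have := (continuous_expNeg.tendsto 0).comp this
    rwa [expNeg_zero] at this
  exact (prob_compl_eq_zero_iff hA).2 (le_antisymm prob_le_one (le_of_tendsto' hlim hbound))

/-! ### Weighted atoms of a Poisson process -/

lemma measurable_weight_indicator {Ω : Type*} [MeasurableSpace Ω] {B : Set Ω}
    (hB : MeasurableSet B) : Measurable
      ((Prod.fst ⁻¹' B).indicator fun x : Ω × ℝ => ENNReal.ofReal x.2) :=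
  (ENNReal.measurable_ofReal.comp measurable_snd).indicator (measurable_fst hB)

lemma weightedAtoms_apply {Ω : Type*} [MeasurableSpace Ω] (N : Measure (Ω × ℝ)) {B : Set Ω}
    (hB : MeasurableSet B) :
    weightedAtoms N B = ∫⁻ x, (Prod.fst ⁻¹' B).indicator (fun x => ENNReal.ofReal x.2) x ∂N := by
  rw [weightedAtoms, Measure.map_apply measurable_fst hB,
    withDensity_apply _ (measurable_fst hB), lintegral_indicator (measurable_fst hB)]

lemma measurable_weightedAtoms {Ω : Type*} [MeasurableSpace Ω] :
    Measurable (weightedAtoms : Measure (Ω × ℝ) → Measure Ω) := by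
  refine Measure.measurable_of_measurable_coe _ fun B hB => ?_
  simp_rw [weightedAtoms_apply _ hB]
  exact Measure.measurable_lintegral (measurable_weight_indicator hB)

lemma HasPoissonLaplace.isCompletelyRandomMeasure_weightedAtoms {Θ Ω : Type*}
    [MeasurableSpace Θ] [MeasurableSpace Ω] {N : Θ → Measure (Ω × ℝ)} {μ : Measure (Ω × ℝ)}
    {P : Measure Θ} [IsProbabilityMeasure P] (h : HasPoissonLaplace N μ P) (hN : Measurable N) :
    IsCompletelyRandomMeasure (fun θ => weightedAtoms (N θ)) P where
  measurable := measurable_weightedAtoms.comp hN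
  indep n A hA hdisj := by
    simp_rw [weightedAtoms_apply _ (hA _)]
    refine h.iIndepFun_lintegral hN _ (fun k => measurable_weight_indicator (hA k))
      fun k l hkl x => ?_
    by_cases hx : x.1 ∈ A k
    · exact Or.inr (by simp [Set.disjoint_left.1 (hdisj hkl) hx])
    · exact Or.inl (by simp [hx])

/-! ### The intensity of the stick-breaking points -/

/-- The `Gamma (i + 1, α)` densities add up to the constant `α` on `(0, ∞)`: the arrival times of
a Poisson process of rate `α` have uniform intensity. -/
lemma tsum_gammaPDF {α : ℝ} (hα : 0 < α) {t : ℝ} (ht : 0 < t) :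
    ∑' i : ℕ, gammaPDF (i + 1) α t = ENNReal.ofReal α := by
  have hterm : ∀ i : ℕ, gammaPDF (i + 1) α t
      = ENNReal.ofReal (α * Real.exp (-(α * t)) * ((α * t) ^ i / i.factorial)) := fun i => by
    rw [gammaPDF_of_nonneg ht.le, Real.Gamma_nat_eq_factorial, add_sub_cancel_right,
      Real.rpow_natCast, Real.rpow_add_one hα.ne', Real.rpow_natCast, mul_pow]
    congr 1
    ring
  have hsum : HasSum (fun i : ℕ => α * Real.exp (-(α * t)) * ((α * t) ^ i / i.factorial))
      (α * Real.exp (-(α * t)) * Real.exp (α * t)) := by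
    have := NormedSpace.expSeries_div_hasSum_exp (α * t)
    rw [← Real.exp_eq_exp_ℝ] at this
    exact this.mul_left _
  simp_rw [hterm]
  rw [← ENNReal.ofReal_tsum_of_nonneg (fun i => by positivity) hsum.summable, hsum.tsum_eq,
    mul_assoc, ← Real.exp_add, neg_add_cancel, Real.exp_zero, mul_one]

@[fun_prop]
lemma measurable_gammaPDF (a r : ℝ) : Measurable (gammaPDF a r) :=
  (measurable_gammaPDFReal a r).ennreal_ofReal

lemma lintegral_gammaMeasure (a r : ℝ) {φ : ℝ → ℝ≥0∞} (hφ : Measurable φ) :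
    ∫⁻ t, φ t ∂gammaMeasure a r = ∫⁻ t, gammaPDF a r t * φ t :=
  lintegral_withDensity_eq_lintegral_mul _ (measurable_gammaPDF _ _) hφ

lemma tsum_lintegral_gammaMeasure {α : ℝ} (hα : 0 < α) {φ : ℝ → ℝ≥0∞} (hφ : Measurable φ) :
    ∑' i : ℕ, ∫⁻ t, φ t ∂gammaMeasure (i + 1) α
      = ∫⁻ t in Set.Ioi 0, ENNReal.ofReal α * φ t := by
  have hone : ∀ i : ℕ, ∫⁻ t, φ t ∂gammaMeasure (i + 1) α
      = ∫⁻ t in Set.Ioi 0, gammaPDF (i + 1) α t * φ t := fun i => by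
    rw [lintegral_gammaMeasure _ _ hφ, setLIntegral_congr Ioi_ae_eq_Ici,
      ← lintegral_indicator measurableSet_Ici]
    refine lintegral_congr fun t => ?_
    by_cases ht : 0 ≤ t
    · simp [ht]
    · simp [gammaPDF_of_neg (not_le.1 ht), not_le.1 ht]
  simp_rw [hone]
  rw [← lintegral_tsum fun i => by fun_prop]
  refine setLIntegral_congr_fun measurableSet_Ioi fun t ht => ?_
  simp only [ENNReal.tsum_mul_right, tsum_gammaPDF hα ht]

/-- If `e` is exponential with rate `c`, then `e / exp t` is exponential with rate `c * exp t`. -/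
lemma lintegral_expMeasure_mul_exp_neg (c t : ℝ) {φ : ℝ → ℝ≥0∞} (hφ : Measurable φ) :
    ∫⁻ e, φ (e * Real.exp (-t)) ∂expMeasure c
      = ∫⁻ p in Set.Ioi 0, ENNReal.ofReal (c * (Real.exp t * Real.exp (-(c * p * Real.exp t))))
        * φ p := by
  have hpos := Real.exp_pos t
  rw [setLIntegral_congr Ioi_ae_eq_Ici, ← lintegral_indicator measurableSet_Ici, expMeasure,
    lintegral_gammaMeasure _ _ (by fun_prop)]
  -- Substitute `e = p * exp t`.
  conv_lhs =>
    rw [← Real.smul_map_volume_mul_left hpos.ne', lintegral_smul_measure,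
      lintegral_map (by fun_prop) (by fun_prop), smul_eq_mul, ← lintegral_const_mul _ (by fun_prop)]
  refine lintegral_congr fun p => ?_
  by_cases hp : 0 ≤ p
  · have hφp : φ (Real.exp t * p * Real.exp (-t)) = φ p := by
      rw [mul_right_comm, ← Real.exp_add, add_neg_cancel, Real.exp_zero, one_mul]
    simp only [Set.mem_Ici, hp, Set.indicator_of_mem, hφp, abs_of_pos hpos]
    rw [gammaPDF_of_nonneg (by positivity), ← mul_assoc, ← ENNReal.ofReal_mul hpos.le]
    congr 2
    simp only [Real.rpow_one, Real.Gamma_one, sub_self, Real.rpow_zero, div_one, mul_one]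
    rw [mul_left_comm, show c * (Real.exp t * p) = c * p * Real.exp t by ring]
  · have : Real.exp t * p < 0 := mul_neg_of_pos_of_neg hpos (not_le.1 hp)
    simp [gammaPDF_of_neg this, not_le.1 hp]

lemma lintegral_exp_mul_exp_neg_mul_exp {a : ℝ} (ha : 0 < a) :
    ∫⁻ t in Set.Ioi 0, ENNReal.ofReal (Real.exp t * Real.exp (-(a * Real.exp t)))
      = ENNReal.ofReal (a⁻¹ * Real.exp (-a)) := by
  have hderiv : ∀ t ∈ Set.Ici (0 : ℝ), HasDerivAt (fun t => -(a⁻¹ * Real.exp (-(a * Real.exp t))))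
      (Real.exp t * Real.exp (-(a * Real.exp t))) t := fun t _ => by
    have := ((((Real.hasDerivAt_exp t).const_mul a).fun_neg.exp).const_mul a⁻¹).fun_neg
    refine this.congr_deriv ?_
    field_simp
  have hlim : Tendsto (fun t => -(a⁻¹ * Real.exp (-(a * Real.exp t)))) atTop (𝓝 (-(a⁻¹ * 0))) :=
    ((Real.tendsto_exp_neg_atTop_nhds_zero.comp
      (Real.tendsto_exp_atTop.const_mul_atTop ha)).const_mul _).neg
  have hnn : ∀ t ∈ Set.Ioi (0 : ℝ), 0 ≤ Real.exp t * Real.exp (-(a * Real.exp t)) :=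
    fun t _ => by positivity
  rw [← ofReal_integral_eq_lintegral_ofReal
    (integrableOn_Ioi_deriv_of_nonneg' hderiv hnn hlim)
    (ae_of_all _ fun t => by positivity),
    integral_Ioi_of_hasDerivAt_of_nonneg' hderiv hnn hlim]
  simp

/-- The intensity of the points `E * exp (-T)`, where `E` is exponential with rate `c` and `T` runs
over the arrival times of a Poisson process of rate `α`, has density `α p⁻¹ exp (-c p)`. -/
lemma tsum_lintegral_expMeasure_gammaMeasure {α c : ℝ} (hα : 0 < α) (hc : 0 < c)
    {φ : ℝ → ℝ≥0∞} (hφ : Measurable φ) :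
    ∑' i : ℕ, ∫⁻ t, ∫⁻ e, φ (e * Real.exp (-t)) ∂expMeasure c ∂gammaMeasure (i + 1) α
      = ∫⁻ p in Set.Ioi 0, ENNReal.ofReal (α * p⁻¹ * Real.exp (-(c * p))) * φ p := by
  have := isProbabilityMeasure_expMeasure hc
  rw [tsum_lintegral_gammaMeasure hα (Measurable.lintegral_prod_right (by fun_prop))]
  simp_rw [lintegral_expMeasure_mul_exp_neg _ _ hφ]
  rw [lintegral_congr fun t => (lintegral_const_mul (ENNReal.ofReal α) (show Measurable fun p =>
    ENNReal.ofReal (c * (Real.exp t * Real.exp (-(c * p * Real.exp t)))) * φ p by fun_prop)).symm]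
  rw [lintegral_lintegral_swap (by fun_prop)]
  refine setLIntegral_congr_fun measurableSet_Ioi fun p (hp : 0 < p) => ?_
  have hpt : ∀ t, ENNReal.ofReal α * (ENNReal.ofReal
      (c * (Real.exp t * Real.exp (-(c * p * Real.exp t)))) * φ p)
      = ENNReal.ofReal (α * c) * φ p
        * ENNReal.ofReal (Real.exp t * Real.exp (-(c * p * Real.exp t))) := fun t => by
    rw [ENNReal.ofReal_mul hα.le, ENNReal.ofReal_mul hc.le]
    ring
  simp only [hpt]
  rw [lintegral_const_mul _ (by fun_prop), lintegral_exp_mul_exp_neg_mul_exp (by positivity),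
    mul_right_comm, ← ENNReal.ofReal_mul (by positivity)]
  congr 2
  field_simp

/-! ### Random products over independent blocks -/

section Blocks

variable {Θ I : Type*} [mΘ : MeasurableSpace Θ] {P : Measure Θ} [IsProbabilityMeasure P]
  {m : I → MeasurableSpace Θ}

/-- Nonnegative variables that depend on pairwise disjoint blocks of an independent family have
multiplicative expectations. -/
lemma lintegral_prod_range_of_iIndep (hle : ∀ a, m a ≤ mΘ) (hind : iIndep m P) (S : ℕ → Set I)
    (hS : Pairwise fun j k => Disjoint (S j) (S k)) (h : ℕ → Θ → ℝ≥0∞)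
    (hh : ∀ j, Measurable[⨆ a ∈ S j, m a] (h j)) (n : ℕ) :
    ∫⁻ θ, ∏ j ∈ Finset.range n, h j θ ∂P = ∏ j ∈ Finset.range n, ∫⁻ θ, h j θ ∂P := by
  induction n with
  | zero => simp
  | succ n ih =>
    simp_rw [Finset.prod_range_succ]
    rw [← ih]
    refine lintegral_mul_eq_lintegral_mul_lintegral_of_independent_measurableSpace
      (iSup₂_le fun a _ => hle a) (iSup₂_le fun a _ => hle a)
      (indep_iSup_of_disjoint hle hind (S := {a | ∃ j < n, a ∈ S j}) (T := S n) ?_) ?_ (hh n)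
    · rw [Set.disjoint_left]
      rintro a ⟨j, hj, ha⟩ ha'
      exact Set.disjoint_left.1 (hS hj.ne) ha ha'
    · refine Finset.measurable_fun_prod _ fun j hj => (hh j).mono ?_ le_rfl
      exact biSup_mono fun a ha => ⟨j, Finset.mem_range.1 hj, ha⟩

/-- A product of a Poisson number of independent factors with common mean `a ≤ 1`. -/
lemma lintegral_prod_range_poisson (hle : ∀ a, m a ≤ mΘ) (hind : iIndep m P) {S₀ : Set I}
    {S : ℕ → Set I} (hS₀ : ∀ j, Disjoint S₀ (S j)) (hS : Pairwise fun j k => Disjoint (S j) (S k))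
    {C : Θ → ℕ} (hC : Measurable[⨆ a ∈ S₀, m a] C) {r : ℝ≥0} (hCP : P.map C = poissonMeasure r)
    {h : ℕ → Θ → ℝ≥0∞} (hh : ∀ j, Measurable[⨆ a ∈ S j, m a] (h j)) {a : ℝ≥0∞} (ha : a ≤ 1)
    (hha : ∀ j, ∫⁻ θ, h j θ ∂P = a) :
    ∫⁻ θ, ∏ j ∈ Finset.range (C θ), h j θ ∂P = expNeg (r * (1 - a)) := by
  have hF : ∀ T : Set I, ⨆ a ∈ T, m a ≤ mΘ := fun T => iSup₂_le fun a _ => hle a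
  have hCm : Measurable C := hC.mono (hF _) le_rfl
  have hhm : ∀ j, Measurable (h j) := fun j => (hh j).mono (hF _) le_rfl
  have hsplit : ∀ θ, ∏ j ∈ Finset.range (C θ), h j θ
      = ∑' k, ({k} : Set ℕ).indicator 1 (C θ) * ∏ j ∈ Finset.range k, h j θ := fun θ => by
    rw [tsum_eq_single (C θ) fun k hk => by simp [hk.symm]]
    simp
  have hdet : ∀ k, Measurable (({k} : Set ℕ).indicator (1 : ℕ → ℝ≥0∞)) := fun k =>
    measurable_one.indicator (measurableSet_singleton k)
  have hterm : ∀ k, ∫⁻ θ, ({k} : Set ℕ).indicator 1 (C θ) * ∏ j ∈ Finset.range k, h j θ ∂P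
      = a ^ k * poissonMeasure r {k} := fun k => by
    rw [lintegral_mul_eq_lintegral_mul_lintegral_of_independent_measurableSpace
      (f := fun θ => ({k} : Set ℕ).indicator 1 (C θ)) (hF _) (hF _)
      (indep_iSup_of_disjoint hle hind (S := S₀) (T := {a | ∃ j, a ∈ S j}) ?_)
      ((hdet k).comp hC) ?_, lintegral_prod_range_of_iIndep hle hind S hS h hh,
      ← lintegral_map (hdet k) hCm, hCP, lintegral_indicator_one (measurableSet_singleton k)]
    · simp [hha, mul_comm]
    · rw [Set.disjoint_left]
      rintro a ha ⟨j, ha'⟩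
      exact Set.disjoint_left.1 (hS₀ j) ha ha'
    · refine Finset.measurable_fun_prod _ fun j hj => (hh j).mono ?_ le_rfl
      exact biSup_mono fun a ha => ⟨j, ha⟩
  simp_rw [hsplit]
  rw [lintegral_tsum (f := fun k θ => ({k} : Set ℕ).indicator 1 (C θ)
    * ∏ j ∈ Finset.range k, h j θ) fun k => (((hdet k).comp hCm).mul
    (Finset.measurable_fun_prod (Finset.range k) fun j _ => hhm j)).aemeasurable]
  simp_rw [hterm]
  rw [← lintegral_countable', lintegral_pow_poissonMeasure r ha]

end Blocks

lemma measurable_sum_range {Θ : Type*} [MeasurableSpace Θ] {C : Θ → ℕ} (hC : Measurable C)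
    {h : ℕ → Θ → ℝ≥0∞} (hh : ∀ j, Measurable (h j)) :
    Measurable fun θ => ∑ j ∈ Finset.range (C θ), h j θ := by
  have : Measurable fun q : ℕ × Θ => ∑ j ∈ Finset.range q.1, h j q.2 :=
    measurable_from_prod_countable_right fun n =>
      Finset.measurable_fun_sum (Finset.range n) fun j _ => hh j
  exact this.comp (hC.prodMk measurable_id)

/-! ### The counting measure of the stick-breaking points -/

section Points

variable {Θ Ω : Type*} [MeasurableSpace Ω] {C : ℕ → Θ → ℕ}
  {E T : ℕ → ℕ → Θ → ℝ} {X : ℕ → ℕ → Θ → Ω}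

lemma lintegral_stickPoints (θ : Θ) {f : Ω × ℝ → ℝ≥0∞} (hf : Measurable f) :
    ∫⁻ x, f x ∂stickPoints C E T X θ
      = ∑' i, ∑ j ∈ Finset.range (C i θ), f (X i j θ, E i j θ * Real.exp (-T i j θ)) := by
  rw [stickPoints, lintegral_sum_measure]
  simp_rw [lintegral_finsetSum_measure, lintegral_dirac' _ hf]

lemma measurable_stickPoints [MeasurableSpace Θ] (hCm : ∀ i, Measurable (C i))
    (hEm : ∀ i j, Measurable (E i j)) (hTm : ∀ i j, Measurable (T i j))
    (hXm : ∀ i j, Measurable (X i j)) : Measurable (stickPoints C E T X) := by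
  refine Measure.measurable_of_measurable_coe _ fun B hB => ?_
  simp_rw [← lintegral_indicator_one hB, lintegral_stickPoints _ (measurable_one.indicator hB)]
  exact Measurable.tsum fun i => measurable_sum_range (hCm i) fun j =>
    (measurable_one.indicator hB).comp
      ((hXm i j).prodMk ((hEm i j).mul (hTm i j).neg.exp))

/-- The stick-breaking points, enumerated by the codes `Nat.pair i j` with `j < C i θ`. -/
lemma exists_stickPoints_eq_sum_dirac (C : ℕ → Θ → ℕ) (E T : ℕ → ℕ → Θ → ℝ)
    (X : ℕ → ℕ → Θ → Ω) (θ : Θ) : ∃ (K : Set ℕ) (x : K → Ω × ℝ),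
    stickPoints C E T X θ = Measure.sum (fun k : K => Measure.dirac (x k)) := by
  let pt : ℕ × ℕ → Ω × ℝ := fun a => (X a.1 a.2 θ, E a.1 a.2 θ * Real.exp (-T a.1 a.2 θ))
  refine ⟨{n | n.unpair.2 < C n.unpair.1 θ}, fun k => pt (k : ℕ).unpair, ?_⟩
  ext B hB
  rw [Measure.sum_apply _ hB, tsum_subtype {n : ℕ | n.unpair.2 < C n.unpair.1 θ}
    (fun n => Measure.dirac (pt n.unpair) B), ← Nat.pairEquiv.tsum_eq, ENNReal.tsum_prod',
    stickPoints, Measure.sum_apply _ hB]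
  refine tsum_congr fun i => ?_
  rw [Measure.finsetSum_apply, tsum_eq_sum (s := Finset.range (C i θ)) fun j hj => by
    have : ¬ j < C i θ := by simpa using hj
    simp [this]]
  refine Finset.sum_congr rfl fun j hj => ?_
  simp [Finset.mem_range.1 hj, pt]

lemma weightedAtoms_stickPoints (C : ℕ → Θ → ℕ) (E T : ℕ → ℕ → Θ → ℝ) (X : ℕ → ℕ → Θ → Ω)
    (θ : Θ) : weightedAtoms (stickPoints C E T X θ) = stickMeasure C E T X θ := by
  ext B hB
  rw [weightedAtoms_apply _ hB, lintegral_stickPoints _ (measurable_weight_indicator hB),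
    stickMeasure, Measure.sum_apply _ hB]
  refine tsum_congr fun i => ?_
  rw [Measure.finsetSum_apply]
  refine Finset.sum_congr rfl fun j _ => ?_
  by_cases hx : X i j θ ∈ B <;> simp [hx, Measure.dirac_apply' _ hB]

end Points

/-! ### The Laplace functional of the stick-breaking points -/

section Laplace

variable {Θ Ω : Type*} [MeasurableSpace Ω] {C : ℕ → Θ → ℕ} {E T : ℕ → ℕ → Θ → ℝ}
  {X : ℕ → ℕ → Θ → Ω}

/-- The σ-algebras generated by the variables `C i`, `E i j`, `T i j`, `X i j`. -/
abbrev stickSigma (C : ℕ → Θ → ℕ) (E T : ℕ → ℕ → Θ → ℝ) (X : ℕ → ℕ → Θ → Ω) :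
    ℕ ⊕ (ℕ × ℕ) ⊕ (ℕ × ℕ) ⊕ (ℕ × ℕ) → MeasurableSpace Θ :=
  Sum.elim (fun i => MeasurableSpace.comap (C i) inferInstance)
    (Sum.elim (fun a => MeasurableSpace.comap (E a.1 a.2) inferInstance)
      (Sum.elim (fun a => MeasurableSpace.comap (T a.1 a.2) inferInstance)
        (fun a => MeasurableSpace.comap (X a.1 a.2) inferInstance)))

/-- The place of a variable in the construction: round `i` and, except for the number of points
`C i`, the number `j` of the point that it belongs to. -/
def stickPlace : ℕ ⊕ (ℕ × ℕ) ⊕ (ℕ × ℕ) ⊕ (ℕ × ℕ) → ℕ × Option ℕ :=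
  Sum.elim (fun i => (i, none)) (Sum.elim (fun a => (a.1, some a.2))
    (Sum.elim (fun a => (a.1, some a.2)) (fun a => (a.1, some a.2))))

lemma disjoint_stickPlace_preimage {A B : Set (ℕ × Option ℕ)} (h : Disjoint A B) :
    Disjoint (stickPlace ⁻¹' A) (stickPlace ⁻¹' B) := h.preimage _

lemma measurable_count_stickSigma (i : ℕ) :
    Measurable[⨆ a ∈ stickPlace ⁻¹' {(i, none)}, stickSigma C E T X a] (C i) :=
  (comap_measurable (C i)).mono (le_iSup₂_of_le (f := fun a _ => stickSigma C E T X a)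
    (Sum.inl i) rfl le_rfl) le_rfl

lemma measurable_point_stickSigma (i j : ℕ) :
    Measurable[⨆ a ∈ stickPlace ⁻¹' {(i, some j)}, stickSigma C E T X a]
      (fun θ => (X i j θ, E i j θ * Real.exp (-T i j θ))) := by
  have hE : Measurable[⨆ a ∈ stickPlace ⁻¹' {(i, some j)}, stickSigma C E T X a] (E i j) :=
    (comap_measurable (E i j)).mono (le_iSup₂_of_le (f := fun a _ => stickSigma C E T X a)
      (Sum.inr (Sum.inl (i, j))) rfl le_rfl) le_rfl
  have hT : Measurable[⨆ a ∈ stickPlace ⁻¹' {(i, some j)}, stickSigma C E T X a] (T i j) :=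
    (comap_measurable (T i j)).mono (le_iSup₂_of_le (f := fun a _ => stickSigma C E T X a)
      (Sum.inr (Sum.inr (Sum.inl (i, j)))) rfl le_rfl) le_rfl
  have hX : Measurable[⨆ a ∈ stickPlace ⁻¹' {(i, some j)}, stickSigma C E T X a] (X i j) :=
    (comap_measurable (X i j)).mono (le_iSup₂_of_le (f := fun a _ => stickSigma C E T X a)
      (Sum.inr (Sum.inr (Sum.inr (i, j)))) rfl le_rfl) le_rfl
  exact hX.prodMk (hE.mul (Real.measurable_exp.comp hT.neg))

/-- The number of points and the points of round `i` depend on the variables of round `i` only. -/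
lemma measurable_prod_range_stickSigma (i : ℕ) {g : Ω × ℝ → ℝ≥0∞} (hg : Measurable g) :
    Measurable[⨆ a ∈ stickPlace ⁻¹' {q | q.1 = i}, stickSigma C E T X a]
      (fun θ => ∏ j ∈ Finset.range (C i θ), g (X i j θ, E i j θ * Real.exp (-T i j θ))) := by
  have hC : Measurable[⨆ a ∈ stickPlace ⁻¹' {q | q.1 = i}, stickSigma C E T X a] (C i) :=
    (measurable_count_stickSigma (E := E) (T := T) (X := X) i).mono
      (biSup_mono fun a (ha : stickPlace a = _) => by simp [ha]) le_rfl
  have hpt : ∀ j, Measurable[⨆ a ∈ stickPlace ⁻¹' {q | q.1 = i}, stickSigma C E T X a]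
      (fun θ => g (X i j θ, E i j θ * Real.exp (-T i j θ))) := fun j =>
    hg.comp ((measurable_point_stickSigma (C := C) i j).mono
      (biSup_mono fun a (ha : stickPlace a = _) => by simp [ha]) le_rfl)
  let _ : MeasurableSpace Θ := ⨆ a ∈ stickPlace ⁻¹' {q | q.1 = i}, stickSigma C E T X a
  have : Measurable fun q : ℕ × Θ => ∏ j ∈ Finset.range q.1,
      g (X i j q.2, E i j q.2 * Real.exp (-T i j q.2)) :=
    measurable_from_prod_countable_right fun n =>
      Finset.measurable_fun_prod (Finset.range n) fun j _ => hpt j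
  exact this.comp (hC.prodMk measurable_id)

variable [mΘ : MeasurableSpace Θ] {P : Measure Θ} [IsProbabilityMeasure P] {H₀ : Measure Ω}
  [IsFiniteMeasure H₀] {α c : ℝ} {γ : ℝ≥0}

lemma stickSigma_le (hCm : ∀ i, Measurable (C i)) (hEm : ∀ i j, Measurable (E i j))
    (hTm : ∀ i j, Measurable (T i j)) (hXm : ∀ i j, Measurable (X i j))
    (a : ℕ ⊕ (ℕ × ℕ) ⊕ (ℕ × ℕ) ⊕ (ℕ × ℕ)) : stickSigma C E T X a ≤ mΘ := by
  rcases a with i | a | a | a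
  · exact (hCm i).comap_le
  · exact (hEm _ _).comap_le
  · exact (hTm _ _).comap_le
  · exact (hXm _ _).comap_le

/-- The law of a single point `(X i j, E i j * exp (-T i j))`. -/
lemma lintegral_point (hα : 0 < α) (hc : 0 < c)
    (hCm : ∀ i, Measurable (C i)) (hEm : ∀ i j, Measurable (E i j))
    (hTm : ∀ i j, Measurable (T i j)) (hXm : ∀ i j, Measurable (X i j))
    (hE : ∀ i j, P.map (E i j) = expMeasure c)
    (hT : ∀ i j, P.map (T i j) = gammaMeasure ((i : ℝ) + 1) α)
    (hX : ∀ i j, P.map (X i j) = (γ : ℝ≥0∞)⁻¹ • H₀)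
    (hindep : StickIndep C E T X P) (i j : ℕ) {g : Ω × ℝ → ℝ≥0∞} (hg : Measurable g) :
    ∫⁻ θ, g (X i j θ, E i j θ * Real.exp (-T i j θ)) ∂P
      = (γ : ℝ≥0∞)⁻¹ * ∫⁻ t, ∫⁻ e, ∫⁻ x, g (x, e * Real.exp (-t)) ∂H₀ ∂expMeasure c
        ∂gammaMeasure ((i : ℝ) + 1) α := by
  have hle := stickSigma_le hCm hEm hTm hXm
  have hind : iIndep (stickSigma C E T X) P := hindep
  have := isProbabilityMeasure_expMeasure hc
  have := isProbabilityMeasure_gammaMeasure (a := (i : ℝ) + 1) (by positivity) hα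
  have hET : IndepFun (T i j) (E i j) P :=
    hind.indep (i := Sum.inr (Sum.inr (Sum.inl (i, j)))) (j := Sum.inr (Sum.inl (i, j))) (by simp)
  have hTEX : IndepFun (fun θ => (T i j θ, E i j θ)) (X i j) P := by
    have hdisj : Disjoint ({Sum.inr (Sum.inr (Sum.inl (i, j))), Sum.inr (Sum.inl (i, j))} :
        Set (ℕ ⊕ (ℕ × ℕ) ⊕ (ℕ × ℕ) ⊕ (ℕ × ℕ))) {Sum.inr (Sum.inr (Sum.inr (i, j)))} := by simp
    have h := indep_iSup_of_disjoint hle hind hdisj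
    rw [iSup_pair, iSup_singleton] at h
    refine indep_of_indep_of_le_left h (Measurable.comap_le ?_)
    refine Measurable.prodMk ?_ ?_
    · exact (comap_measurable (T i j)).mono le_sup_left le_rfl
    · exact (comap_measurable (E i j)).mono le_sup_right le_rfl
  have hTE : Measurable fun θ => (T i j θ, E i j θ) := (hTm i j).prodMk (hEm i j)
  have hlaw : P.map (fun θ => ((T i j θ, E i j θ), X i j θ))
      = ((gammaMeasure ((i : ℝ) + 1) α).prod (expMeasure c)).prod ((γ : ℝ≥0∞)⁻¹ • H₀) := by
    rw [(indepFun_iff_map_prod_eq_prod_map_map hTE.aemeasurable (hXm i j).aemeasurable).1 hTEX,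
      (indepFun_iff_map_prod_eq_prod_map_map (hTm i j).aemeasurable (hEm i j).aemeasurable).1 hET,
      hT, hE, hX]
  have hG : Measurable fun q : (ℝ × ℝ) × Ω => g (q.2, q.1.2 * Real.exp (-q.1.1)) := by fun_prop
  have hfin : SFinite ((γ : ℝ≥0∞)⁻¹ • H₀) := by
    rw [← hX i j]
    infer_instance
  calc ∫⁻ θ, g (X i j θ, E i j θ * Real.exp (-T i j θ)) ∂P
      = ∫⁻ q, g (q.2, q.1.2 * Real.exp (-q.1.1))
          ∂(P.map fun θ => ((T i j θ, E i j θ), X i j θ)) :=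
        (lintegral_map hG (hTE.prodMk (hXm i j))).symm
    _ = _ := by
        rw [hlaw, lintegral_prod _ hG.aemeasurable]
        simp_rw [lintegral_smul_measure, smul_eq_mul]
        rw [lintegral_const_mul _ (Measurable.lintegral_prod_right hG),
          lintegral_prod _ (Measurable.lintegral_prod_right hG).aemeasurable]

/-- The expected sum of `g` over the points is the integral of `g` against the rate
measure of the gamma process. -/
lemma tsum_lintegral_point (hα : 0 < α) (hc : 0 < c) (hγ : 0 < γ)
    (hCm : ∀ i, Measurable (C i)) (hEm : ∀ i j, Measurable (E i j))
    (hTm : ∀ i j, Measurable (T i j)) (hXm : ∀ i j, Measurable (X i j))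
    (hE : ∀ i j, P.map (E i j) = expMeasure c)
    (hT : ∀ i j, P.map (T i j) = gammaMeasure ((i : ℝ) + 1) α)
    (hX : ∀ i j, P.map (X i j) = (γ : ℝ≥0∞)⁻¹ • H₀)
    (hindep : StickIndep C E T X P) {g : Ω × ℝ → ℝ≥0∞} (hg : Measurable g) :
    ∑' i, γ * ∫⁻ θ, g (X i 0 θ, E i 0 θ * Real.exp (-T i 0 θ)) ∂P
      = ∫⁻ x, g x ∂gammaRate c (ENNReal.ofReal (α / c) • H₀) := by
  have hφ : Measurable fun p => ∫⁻ x, g (x, p) ∂H₀ := hg.lintegral_prod_left'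
  have hγ0 : (γ : ℝ≥0∞) ≠ 0 := by exact_mod_cast hγ.ne'
  simp_rw [lintegral_point hα hc hCm hEm hTm hXm hE hT hX hindep _ 0 hg, ← mul_assoc,
    ENNReal.mul_inv_cancel hγ0 ENNReal.coe_ne_top, one_mul]
  rw [tsum_lintegral_expMeasure_gammaMeasure hα hc hφ, gammaRate, lintegral_prod_symm' _ hg,
    lintegral_withDensity_eq_lintegral_mul _ (by fun_prop)
      (Measurable.lintegral_prod_left' hg)]
  refine setLIntegral_congr_fun measurableSet_Ioi fun p (hp : 0 < p) => ?_
  simp only [Pi.mul_apply, lintegral_smul_measure, smul_eq_mul]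
  rw [← mul_assoc, ← ENNReal.ofReal_mul (by positivity)]
  congr 2
  field_simp

/-- Round `i` contributes the factor `exp (-γ (1 - a i))` to the Laplace functional at `f`, where
`a i` is the mean of `exp (-f)` at a point of that round; the exponents `γ (1 - a i)` add up to the
integral of `1 - exp (-f)` against the rate measure. -/
lemma hasPoissonLaplace_stickPoints (hα : 0 < α) (hc : 0 < c) (hγ : 0 < γ)
    (hCm : ∀ i, Measurable (C i)) (hEm : ∀ i j, Measurable (E i j))
    (hTm : ∀ i j, Measurable (T i j)) (hXm : ∀ i j, Measurable (X i j))
    (hC : ∀ i, P.map (C i) = poissonMeasure γ)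
    (hE : ∀ i j, P.map (E i j) = expMeasure c)
    (hT : ∀ i j, P.map (T i j) = gammaMeasure ((i : ℝ) + 1) α)
    (hX : ∀ i j, P.map (X i j) = (γ : ℝ≥0∞)⁻¹ • H₀)
    (hindep : StickIndep C E T X P) :
    HasPoissonLaplace (stickPoints C E T X) (gammaRate c (ENNReal.ofReal (α / c) • H₀)) P := by
  intro f hf
  have hle := stickSigma_le hCm hEm hTm hXm
  have hind : iIndep (stickSigma C E T X) P := hindep
  have hgm : Measurable fun x => expNeg (f x) := by fun_prop
  have hptm : ∀ i j, Measurable fun θ => (X i j θ, E i j θ * Real.exp (-T i j θ)) := fun i j =>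
    (hXm i j).prodMk ((hEm i j).mul (hTm i j).neg.exp)
  let h : ℕ → Θ → ℝ≥0∞ := fun i θ => ∏ j ∈ Finset.range (C i θ),
    expNeg (f (X i j θ, E i j θ * Real.exp (-T i j θ)))
  let a : ℕ → ℝ≥0∞ := fun i => ∫⁻ θ, expNeg (f (X i 0 θ, E i 0 θ * Real.exp (-T i 0 θ))) ∂P
  have ha : ∀ i, a i ≤ 1 := fun i => by
    calc a i ≤ ∫⁻ _, 1 ∂P := lintegral_mono fun θ => expNeg_le_one _
      _ = 1 := by simp
  have hround : ∀ i, ∫⁻ θ, h i θ ∂P = expNeg (γ * (1 - a i)) := fun i => by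
    refine lintegral_prod_range_poisson hle hind (S := fun j => stickPlace ⁻¹' {(i, some j)})
      (fun j => disjoint_stickPlace_preimage (by simp))
      (fun j k hjk => disjoint_stickPlace_preimage (by simpa using hjk))
      (measurable_count_stickSigma i) (hC i)
      (fun j => hgm.comp (measurable_point_stickSigma i j)) (ha i) fun j => ?_
    exact (lintegral_point hα hc hCm hEm hTm hXm hE hT hX hindep i j hgm).trans
      (lintegral_point hα hc hCm hEm hTm hXm hE hT hX hindep i 0 hgm).symm
  have hprod : ∀ n, ∫⁻ θ, ∏ i ∈ Finset.range n, h i θ ∂P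
      = ∏ i ∈ Finset.range n, expNeg (γ * (1 - a i)) := fun n => by
    rw [lintegral_prod_range_of_iIndep hle hind (fun i => stickPlace ⁻¹' {q | q.1 = i})
      (fun i k hik => disjoint_stickPlace_preimage (Set.disjoint_left.2 fun q hq hq' =>
        hik (hq.symm.trans hq'))) h (fun i => measurable_prod_range_stickSigma i hgm) n]
    exact Finset.prod_congr rfl fun i _ => hround i
  have hhm : ∀ i, Measurable (h i) := fun i =>
    (measurable_prod_range_stickSigma i hgm).mono (iSup₂_le fun a _ => hle a) le_rfl
  have hpt : ∀ θ, Tendsto (fun n => ∏ i ∈ Finset.range n, h i θ) atTop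
      (𝓝 (expNeg (∫⁻ x, f x ∂stickPoints C E T X θ))) := fun θ => by
    rw [lintegral_stickPoints θ hf]
    simpa only [expNeg_sum] using tendsto_prod_expNeg fun i =>
      ∑ j ∈ Finset.range (C i θ), f (X i j θ, E i j θ * Real.exp (-T i j θ))
  -- The partial products are bounded by `1`, so the expectation passes to the limit `n → ∞`.
  have hlim := tendsto_lintegral_of_dominated_convergence (μ := P) (fun _ => 1)
    (fun n => Finset.measurable_fun_prod (Finset.range n) fun i _ => hhm i)
    (fun n => Eventually.of_forall fun θ => Finset.prod_le_one' fun i _ =>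
      Finset.prod_le_one' fun j _ => expNeg_le_one _) (by simp)
    (Eventually.of_forall hpt)
  simp_rw [hprod] at hlim
  rw [tendsto_nhds_unique hlim (tendsto_prod_expNeg _),
    ← tsum_lintegral_point hα hc hγ hCm hEm hTm hXm hE hT hX hindep
      (show Measurable fun x => 1 - expNeg (f x) from measurable_const.sub hgm)]
  congr 1
  refine tsum_congr fun i => ?_
  rw [lintegral_sub (f := fun _ => 1) (show Measurable fun θ => expNeg (f (X i 0 θ,
    E i 0 θ * Real.exp (-T i 0 θ))) from hgm.comp (hptm i 0))
    ((ha i).trans_lt ENNReal.one_lt_top).ne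
    (Eventually.of_forall fun θ => expNeg_le_one _)]
  simp [a]

end Laplace

/-- The expected total mass `G₀(Ω)` is finite, since the factor `p` cancels the
singularity of the density of the rate measure at `0`. -/
lemma lintegral_weight_gammaRate_ne_top {Ω : Type*} [MeasurableSpace Ω] (G₀ : Measure Ω)
    [IsFiniteMeasure G₀] {c : ℝ} (hc : 0 < c) :
    ∫⁻ x, ENNReal.ofReal x.2 ∂gammaRate c G₀ ≠ ∞ := by
  rw [gammaRate, lintegral_prod_symm' _ (by fun_prop)]
  simp only [lintegral_const]
  rw [lintegral_mul_const _ (by fun_prop),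
    lintegral_withDensity_eq_lintegral_mul _ (by fun_prop) (by fun_prop)]
  refine ENNReal.mul_ne_top ?_ (measure_ne_top _ _)
  have hint : IntegrableOn (fun p => c * Real.exp (-c * p)) (Set.Ioi 0) :=
    (integrableOn_exp_mul_Ioi (neg_neg_of_pos hc) 0).const_mul c
  refine (lt_of_le_of_lt (le_of_eq ?_) hint.lintegral_lt_top).ne
  refine setLIntegral_congr_fun measurableSet_Ioi fun p (hp : 0 < p) => ?_
  rw [Pi.mul_apply, ← ENNReal.ofReal_mul (by positivity), neg_mul]
  congr 1
  field_simp

end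

/-! ### The gamma process -/

theorem theorem1 {Θ Ω : Type*} [MeasurableSpace Θ] [MeasurableSpace Ω]
    (P : Measure Θ) [IsProbabilityMeasure P]
    (H₀ : Measure Ω) [IsFiniteMeasure H₀]
    (α c : ℝ) (hα : 0 < α) (hc : 0 < c)
    (γ : ℝ≥0) (hγ : 0 < γ) (hH₀ : H₀ Set.univ = γ)
    (C : ℕ → Θ → ℕ) (E T : ℕ → ℕ → Θ → ℝ) (X : ℕ → ℕ → Θ → Ω)
    (hCm : ∀ i, Measurable (C i)) (hEm : ∀ i j, Measurable (E i j))
    (hTm : ∀ i j, Measurable (T i j)) (hXm : ∀ i j, Measurable (X i j))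
    (hC : ∀ i, P.map (C i) = poissonMeasure γ)
    (hE : ∀ i j, P.map (E i j) = expMeasure c)
    (hT : ∀ i j, P.map (T i j) = gammaMeasure ((i : ℝ) + 1) α)
    (hX : ∀ i j, P.map (X i j) = (γ : ℝ≥0∞)⁻¹ • H₀)
    (hindep : StickIndep C E T X P) :
    IsGammaCRM (stickMeasure C E T X) c (ENNReal.ofReal (α / c) • H₀) P ∧
    IsPoissonProcess (stickPoints C E T X)
      (gammaRate c (ENNReal.ofReal (α / c) • H₀)) P := by
  have hN := measurable_stickPoints hCm hEm hTm hXm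
  have hL := hasPoissonLaplace_stickPoints hα hc hγ hCm hEm hTm hXm hC hE hT hX hindep
  have hpois := hL.isPoissonProcess hN (exists_stickPoints_eq_sum_dirac C E T X)
  have hG : stickMeasure C E T X = fun θ => weightedAtoms (stickPoints C E T X θ) :=
    funext fun θ => (weightedAtoms_stickPoints C E T X θ).symm
  have : IsFiniteMeasure (ENNReal.ofReal (α / c) • H₀) := H₀.smul_finite ENNReal.ofReal_ne_top
  refine ⟨⟨hG ▸ hL.isCompletelyRandomMeasure_weightedAtoms hN, ?_,
    stickPoints C E T X, hpois, ae_of_all _ fun θ => congrFun hG θ⟩, hpois⟩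
  filter_upwards [hL.ae_lintegral_lt_top hN (f := fun x => ENNReal.ofReal x.2) (by fun_prop)
    (lintegral_weight_gammaRate_ne_top _ hc)] with θ hθ
  rw [hG, weightedAtoms_apply _ MeasurableSet.univ]
  simpa using hθ
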